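/- Let $n,m\in\mathbb N_0$, let $L\in\mathbb R^{m\times n}$ with transpose $L^*$ and null space $\mathcal N(L)$, and let $\|\cdot\|$ be an arbitrary norm on $\mathbb R^m$ with dual norm $\|p\|_*=\max_{\|y\|\le 1}\langle p,y\rangle$. Write $\Gamma_0(X)$ for the set of proper, convex, lower semicontinuous functions $X\to\mathbb R\cup\{+\infty\}$, $\operatorname{dom} f=\{x: f(x)<+\infty\}$, and $\Phi^*(p)=\sup_{x\in\mathbb R^n}\{\langle p,x\rangle-\Phi(x)\}$. Let $\Phi\in\Gamma_0(\mathbb R^n)$. Suppose that $\mathbb R^n=X_1\oplus X_2\oplus X_3$ with pairwise orthogonal subspaces $X_1,X_2,X_3$, and that, for all $x_i\in X_i$ $(i=1,2,3)$, $$\Phi(x_1+x_2+x_3)=\begin{cases}\phi(x_1)&\text{if }x_3=0,\\ +\infty&\text{if }x_3\neq 0,\end{cases}$$ where $\phi=\Phi|_{X_1}:X_1\to\mathbb R\cup\{+\infty\}$ satisfies: 1. $\operatorname{dom}\phi$ is open in $X_1$ and $0\in\overline{\operatorname{dom}\phi}$; 2. $\phi\in\Gamma_0(X_1)$, $\phi$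 is strictly convex (on $\operatorname{dom}\phi$), and $\phi$ is essentially smooth, i.e. $C=\operatorname{int}(\operatorname{dom}\phi)$ (interior in $X_1$) is nonempty, $\phi$ is differentiable on $C$, and $\|\nabla\phi(u_k)\|_2\to+\infty$ for every sequence $(u_k)$ in $C$ that converges to a boundary point of $C$; 3. $\phi$ has a minimizer. Assume $X_2\cap\mathcal N(L)=\{0\}$ and $\operatorname{argmin}\Phi\cap\mathcal N(L)=\emptyset$. Then for all $\tau,\lambda\in(0,+\infty)$ each of the problems $$(P_{1,\tau})\quad \text{minimize } \Phi(x)\ \text{ over } x\in\mathbb R^n\ \text{ with } \|Lx\|\le\tau,$$ $$(P_{2,\lambda})\quad \text{minimize } \Phi(x)+\lambda\|Lx\|\ \text{ over } x\in\mathbb R^n,$$ $$(D_{1,\tau})\quad \text{minimize } \Phi^*(-L^*p)+\tau\|p\|_*\ \text{ over } p\in\mathbb R^m,$$ $$(D_{2,\lambda})\quad \text{minimize } \Phi^*(-L^*p)\ \text{ over } p\in\mathbb R^m\ \text{ with } \|p\|_*\le\lambda$$ has a nonempty set of solutions, and its minimum is finite (a real number). -/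

import Mathlib

open Filter Topology

namespace Solvers

section General

variable {E : Type*} [NormedAddCommGroup E] [InnerProductSpace ℝ E]

/-- The effective domain of an extended-real-valued function. -/
def effDom (f : E → EReal) : Set E := {x | f x < ⊤}

/-- `f` is proper, convex and closed (lower semicontinuous), with values in `ℝ ∪ {+∞}`.
Convexity is convexity of the epigraph. -/
structure IsGammaZero (f : E → EReal) : Prop where
  ne_bot : ∀ x, f x ≠ ⊥
  dom_nonempty : (effDom f).Nonempty
  convex : Convex ℝ {q : E × ℝ | f q.1 ≤ (q.2 : EReal)}
  lsc : LowerSemicontinuous f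

/-- Strict convexity of a proper function: it is strictly convex, as a real-valued function,
on its effective domain. -/
def IsStrictlyConvex (f : E → EReal) : Prop :=
  StrictConvexOn ℝ (effDom f) (fun x => (f x).toReal)

/-- Essential smoothness of a proper convex function: the interior `C` of the
effective domain is nonempty, `f` is differentiable on `C`, and the norm of the derivative (which
is the Euclidean norm of the gradient) tends to `+∞` along every sequence in `C` that converges to
a boundary point of `C`. -/
structure IsEssentiallySmooth (f : E → EReal) : Prop where
  interior_nonempty : (interior (effDom f)).Nonempty
  differentiable : ∀ x ∈ interior (effDom f), DifferentiableAt ℝ (fun y => (f y).toReal) x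
  steep : ∀ x ∈ frontier (interior (effDom f)), ∀ u : ℕ → E,
    (∀ k, u k ∈ interior (effDom f)) → Tendsto u atTop (𝓝 x) →
      Tendsto (fun k => ‖fderiv ℝ (fun y => (f y).toReal) (u k)‖) atTop atTop

/-- The Fenchel conjugate `f*(p) = sup_x (⟨p, x⟩ - f x)`. -/
noncomputable def conjugate (f : E → EReal) (p : E) : EReal :=
  ⨆ x : E, (((inner ℝ p x : ℝ) : EReal) - f x)

/-- The set of minimizers of `f` subject to the constraint `x ∈ S`. -/
def argminOn (f : E → EReal) (S : Set E) : Set E := {x | x ∈ S ∧ ∀ y ∈ S, f x ≤ f y}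

/-- The set of minimizers of `f` on the whole space. -/
def argmin (f : E → EReal) : Set E := argminOn f Set.univ

/-- The problem of minimizing `f` over `S` has a solution, and its minimum is a real number. -/
def HasSolutionWithFiniteMin (f : E → EReal) (S : Set E) : Prop :=
  (argminOn f S).Nonempty ∧ ∃ r : ℝ, IsLeast (f '' S) (r : EReal)

/-- The dual norm `‖p‖_* = max {⟨p, x⟩ : ‖x‖ ≤ 1}` of a norm `N`. -/
noncomputable def dualNorm (N : Seminorm ℝ E) (p : E) : ℝ :=
  sSup {r : ℝ | ∃ x : E, N x ≤ 1 ∧ r = inner ℝ p x}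

/-- The ambient space is the direct sum of the pairwise orthogonal subspaces `X₁`, `X₂`, `X₃`
(directness follows from orthogonality), and
`Φ (x₁ + x₂ + x₃)` is `φ x₁` if `x₃ = 0` and `+∞` otherwise, where the restriction `φ = Φ|_{X₁}`
has an effective domain that is open in `X₁` and whose closure contains `0`, is proper, convex and
closed, strictly convex and essentially smooth, and has a minimizer. -/
structure IsSetting (Φ : E → EReal) (X₁ X₂ X₃ : Submodule ℝ E) : Prop where
  span : X₁ ⊔ X₂ ⊔ X₃ = ⊤
  orth₁₂ : X₁ ⟂ X₂
  orth₁₃ : X₁ ⟂ X₃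
  orth₂₃ : X₂ ⟂ X₃
  eq_of_eq_zero : ∀ x₁ ∈ X₁, ∀ x₂ ∈ X₂, ∀ x₃ ∈ X₃, x₃ = 0 → Φ (x₁ + x₂ + x₃) = Φ x₁
  eq_of_ne_zero : ∀ x₁ ∈ X₁, ∀ x₂ ∈ X₂, ∀ x₃ ∈ X₃, x₃ ≠ 0 → Φ (x₁ + x₂ + x₃) = ⊤
  dom_open : IsOpen (effDom (fun x : X₁ => Φ x))
  zero_mem : (0 : X₁) ∈ closure (effDom (fun x : X₁ => Φ x))
  gammaZero : IsGammaZero (fun x : X₁ => Φ x)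
  strictlyConvex : IsStrictlyConvex (fun x : X₁ => Φ x)
  essentiallySmooth : IsEssentiallySmooth (fun x : X₁ => Φ x)
  exists_minimizer : (argmin (fun x : X₁ => Φ x)).Nonempty

end General

end Solvers

namespace Solvers

section General

variable {E : Type*} [NormedAddCommGroup E] [InnerProductSpace ℝ E]

/-! All four objectives are lower semicontinuous, so by compactness it is enough to find a feasible
point of finite value whose sublevel set is bounded (`hasSolutionWithFiniteMin_of_bounded`). Primal
side: strict convexity makes the minimizer of `φ` unique, which forces bounded sublevel sets and so
bounds the `X₁` component. A bound on the norm of `L x` then bounds the `X₂` component, since `L` is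
injective on `X₂`; the `X₃` component vanishes wherever `Φ` is finite. Dual side: `Φ` is bounded
below, so the conjugate is finite at `0`. The ball constraint is itself bounded. In the penalized
problem, some `x` in the domain has `‖L x‖ ≤ τ/2`, because `0` lies in the closure of the domain;
the Fenchel inequality at `x` lets the conjugate term decrease at rate at most `τ/2` in the dual
norm, and the penalty of slope `τ` wins. -/

theorem lowerSemicontinuous_add_coe {X : Type*} [TopologicalSpace X] {f : X → EReal} {g : X → ℝ}
    (hf : LowerSemicontinuous f) (hg : LowerSemicontinuous g) :
    LowerSemicontinuous fun x => f x + ((g x : ℝ) : EReal) := by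
  have hg' : LowerSemicontinuous fun x => ((g x : ℝ) : EReal) :=
    continuous_coe_real_ereal.comp_lowerSemicontinuous hg
      fun a b h => EReal.coe_le_coe_iff.2 h
  exact LowerSemicontinuous.add' hf hg' fun x =>
    EReal.continuousAt_add (Or.inr (EReal.coe_ne_bot _)) (Or.inr (EReal.coe_ne_top _))

theorem add_coe_ne_bot {a : EReal} (ha : a ≠ ⊥) (r : ℝ) : a + (r : EReal) ≠ ⊥ := by
  induction a <;> simp_all [← EReal.coe_add]

/-- In the segment from `x` to `y`, a convex function lies below the chord. -/
theorem IsGammaZero.le_chord {f : E → EReal} (hf : IsGammaZero f) {x y : E} {a b t : ℝ}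
    (hx : f x ≤ a) (hy : f y ≤ b) (ht₀ : 0 ≤ t) (ht₁ : t ≤ 1) :
    f ((1 - t) • x + t • y) ≤ (((1 - t) * a + t * b : ℝ) : EReal) := by
  have h := hf.convex (x := (x, a)) hx (y := (y, b)) hy (sub_nonneg.2 ht₁) ht₀ (by ring)
  simpa using h

theorem le_conjugate (f : E → EReal) (p x : E) :
    ((inner ℝ p x : ℝ) : EReal) - f x ≤ conjugate f p :=
  le_iSup (fun x : E => ((inner ℝ p x : ℝ) : EReal) - f x) x

theorem lowerSemicontinuous_conjugate (f : E → EReal) : LowerSemicontinuous (conjugate f) := by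
  refine lowerSemicontinuous_iSup fun x => ?_
  have hc : Continuous fun p : E => ((inner ℝ p x : ℝ) : EReal) :=
    continuous_coe_real_ereal.comp (by fun_prop)
  simp only [sub_eq_add_neg]
  exact LowerSemicontinuous.add' hc.lowerSemicontinuous lowerSemicontinuous_const fun p =>
    EReal.continuousAt_add (Or.inl (EReal.coe_ne_top _)) (Or.inl (EReal.coe_ne_bot _))

theorem coe_le_conjugate {f : E → EReal} {x : E} {c : ℝ} (hx : f x = c)
    (p : E) : ((inner ℝ p x - c : ℝ) : EReal) ≤ conjugate f p := by
  simpa [hx] using le_conjugate f p x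

/-- A point of the effective domain has no component in `X₃`. -/
theorem IsSetting.exists_decomposition {Φ : E → EReal} {X₁ X₂ X₃ : Submodule ℝ E}
    (h : IsSetting Φ X₁ X₂ X₃) {x : E} (hx : Φ x < ⊤) :
    ∃ x₁ ∈ X₁, ∃ x₂ ∈ X₂, x = x₁ + x₂ ∧ Φ x = Φ x₁ := by
  obtain ⟨y, hy, x₃, h₃, rfl⟩ := Submodule.mem_sup.1
    (h.span ▸ Submodule.mem_top : x ∈ X₁ ⊔ X₂ ⊔ X₃)
  obtain ⟨x₁, h₁, x₂, h₂, rfl⟩ := Submodule.mem_sup.1 hy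
  have h0 : x₃ = 0 := by
    by_contra hne
    exact hx.ne (h.eq_of_ne_zero x₁ h₁ x₂ h₂ x₃ h₃ hne)
  exact ⟨x₁, h₁, x₂, h₂, by simp [h0], h.eq_of_eq_zero x₁ h₁ x₂ h₂ x₃ h₃ h0⟩

theorem IsSetting.exists_lowerBound {Φ : E → EReal} {X₁ X₂ X₃ : Submodule ℝ E}
    (h : IsSetting Φ X₁ X₂ X₃) :
    ∃ μ : ℝ, ∀ x, (μ : EReal) ≤ Φ x := by
  obtain ⟨z, -, hz⟩ := h.exists_minimizer
  obtain ⟨y, hy⟩ := h.gammaZero.dom_nonempty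
  have hztop : Φ z < ⊤ := lt_of_le_of_lt (hz y trivial) hy
  refine ⟨(Φ z).toReal, fun x => ?_⟩
  rw [EReal.coe_toReal hztop.ne (h.gammaZero.ne_bot z)]
  rcases eq_or_ne (Φ x) ⊤ with hx | hx
  · simp [hx]
  · obtain ⟨x₁, h₁, -, -, -, he⟩ := h.exists_decomposition (lt_top_iff_ne_top.2 hx)
    exact he ▸ hz ⟨x₁, h₁⟩ trivial

theorem IsSetting.exists_conjugate_zero_le {Φ : E → EReal} {X₁ X₂ X₃ : Submodule ℝ E}
    (h : IsSetting Φ X₁ X₂ X₃) :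
    ∃ b : ℝ, conjugate Φ 0 ≤ b := by
  obtain ⟨μ, hμ⟩ := h.exists_lowerBound
  refine ⟨-μ, iSup_le fun x => ?_⟩
  simpa using hμ x

end General

/-! ### Existence by compactness, and bounded sublevel sets. -/

section FiniteDimensional

variable {E F : Type*} [NormedAddCommGroup E] [InnerProductSpace ℝ E] [FiniteDimensional ℝ E]
  [NormedAddCommGroup F] [InnerProductSpace ℝ F] [FiniteDimensional ℝ F]

/-- A lower semicontinuous function that is nowhere `⊥` attains a finite minimum over a closed set
as soon as one of its sublevel sets in it, at a finite value, is bounded. -/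
theorem hasSolutionWithFiniteMin_of_bounded {f : E → EReal} {S : Set E}
    (hf : LowerSemicontinuous f) (hS : IsClosed S) (hbot : ∀ x ∈ S, f x ≠ ⊥) {x₀ : E}
    (hx₀ : x₀ ∈ S) (htop : f x₀ < ⊤) {R : ℝ} (hR : ∀ x ∈ S, f x ≤ f x₀ → ‖x‖ ≤ R) :
    HasSolutionWithFiniteMin f S := by
  have : ProperSpace E := FiniteDimensional.proper ℝ E
  have hK : IsCompact (S ∩ f ⁻¹' Set.Iic (f x₀)) := by
    refine (isCompact_closedBall (0 : E) R).of_isClosed_subset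
      (hS.inter (hf.isClosed_preimage _)) fun x hx => ?_
    simpa using hR x hx.1 hx.2
  have hne : (S ∩ f ⁻¹' Set.Iic (f x₀)).Nonempty := ⟨x₀, hx₀, le_refl (f x₀)⟩
  obtain ⟨z, hz, hmin⟩ := LowerSemicontinuousOn.exists_isMinOn hne hK (hf.lowerSemicontinuousOn _)
  have hz' : ∀ y ∈ S, f z ≤ f y := fun y hy => by
    rcases le_total (f y) (f x₀) with h | h
    · exact hmin ⟨hy, h⟩
    · exact le_trans hz.2 h
  refine ⟨⟨z, hz.1, hz'⟩, (f z).toReal, ?_⟩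
  rw [EReal.coe_toReal (lt_of_le_of_lt hz.2 htop).ne (hbot z hz.1)]
  exact ⟨⟨z, hz.1, rfl⟩, by rintro _ ⟨y, hy, rfl⟩; exact hz' y hy⟩

/-- The sublevel sets of a strictly convex function with a minimizer are bounded. -/
theorem IsGammaZero.bounded_sublevel {f : E → EReal} (hf : IsGammaZero f)
    (hs : IsStrictlyConvex f) (hmin : (argmin f).Nonempty) (c : ℝ) :
    ∃ R : ℝ, ∀ x, f x ≤ c → ‖x‖ ≤ R := by
  have : ProperSpace E := FiniteDimensional.proper ℝ E
  obtain ⟨z, -, hz⟩ := hmin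
  replace hz : ∀ y, f z ≤ f y := fun y => hz y trivial
  have hztop : f z < ⊤ := by
    obtain ⟨y, hy⟩ := hf.dom_nonempty
    exact lt_of_le_of_lt (hz y) hy
  obtain ⟨μ, hμ⟩ : ∃ μ : ℝ, f z = μ :=
    ⟨(f z).toReal, (EReal.coe_toReal hztop.ne (hf.ne_bot z)).symm⟩
  -- A second minimizer would make the midpoint strictly better than both.
  have huniq : ∀ y, y ≠ z → f z < f y := fun y hy => by
    refine lt_of_le_of_ne (hz y) fun h => ?_
    have hzdom : z ∈ effDom f := hztop
    have hydom : y ∈ effDom f := h.symm.trans_lt hztop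
    obtain ⟨hconv, hstrict⟩ : StrictConvexOn ℝ (effDom f) fun x => (f x).toReal := hs
    have hlt := hstrict hydom hzdom hy
      (a := 1 / 2) (b := 1 / 2) (by norm_num) (by norm_num) (by norm_num)
    have hle := hz ((1 / 2 : ℝ) • y + (1 / 2 : ℝ) • z)
    have hmem := hconv hydom hzdom
      (a := 1 / 2) (b := 1 / 2) (by norm_num) (by norm_num) (by norm_num)
    have := EReal.toReal_le_toReal hle (hf.ne_bot z) (ne_of_lt hmem)
    simp only [← h, smul_eq_mul] at hlt
    linarith
  obtain ⟨a, hμa, ha⟩ : ∃ a : ℝ, μ < a ∧ ∀ y, ‖y - z‖ = 1 → (a : EReal) ≤ f y := by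
    rcases (Metric.sphere z 1).eq_empty_or_nonempty with he | hne
    -- The unit sphere is empty only in the trivial space, where any value above `μ` serves.
    · refine ⟨μ + 1, by linarith, fun y hy => ?_⟩
      have : y ∈ Metric.sphere z 1 := by simpa [dist_eq_norm] using hy
      simp [he] at this
    · obtain ⟨w, hw, hwmin⟩ := LowerSemicontinuousOn.exists_isMinOn hne
        (isCompact_sphere z 1) (hf.lsc.lowerSemicontinuousOn _)
      have hwz : w ≠ z := by rintro rfl; simp at hw
      obtain ⟨a, h₁, h₂⟩ := EReal.lt_iff_exists_real_btwn.1 (hμ ▸ huniq w hwz)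
      refine ⟨a, EReal.coe_lt_coe_iff.1 h₁, fun y hy => h₂.le.trans (hwmin ?_)⟩
      simpa [dist_eq_norm] using hy
  refine ⟨‖z‖ + max 1 ((c - μ) / (a - μ)), fun x hx => ?_⟩
  have hle : ‖x - z‖ ≤ max 1 ((c - μ) / (a - μ)) := by
    rcases le_or_gt ‖x - z‖ 1 with h | h
    · exact le_max_of_le_left h
    · refine le_max_of_le_right ?_
      have hpos : 0 < ‖x - z‖ := by linarith
      -- The chord from `z` to `x` crosses the unit sphere about `z`, where `f ≥ a > μ`; hence `f`
      -- grows at least linearly, with slope `a - μ`, beyond it.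
      have hchord := hf.le_chord hμ.le hx (inv_nonneg.2 hpos.le) (inv_le_one_of_one_le₀ h.le)
      have hnorm : ‖((1 - ‖x - z‖⁻¹) • z + ‖x - z‖⁻¹ • x) - z‖ = 1 := by
        have : ((1 - ‖x - z‖⁻¹) • z + ‖x - z‖⁻¹ • x) - z = ‖x - z‖⁻¹ • (x - z) := by module
        rw [this, norm_smul, norm_inv, norm_norm, inv_mul_cancel₀ hpos.ne']
      have := EReal.coe_le_coe_iff.1 ((ha _ hnorm).trans hchord)
      rw [le_div_iff₀ (by linarith)]
      have h2 : ‖x - z‖ * a ≤ ‖x - z‖ * ((1 - ‖x - z‖⁻¹) * μ + ‖x - z‖⁻¹ * c) := by gcongr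
      have h3 : ‖x - z‖ * ((1 - ‖x - z‖⁻¹) * μ + ‖x - z‖⁻¹ * c) = ‖x - z‖ * μ - μ + c := by
        field_simp
      linarith
  have := norm_le_norm_add_norm_sub' x z
  linarith

/-! ### Norm equivalence and the dual norm. -/

section Norms

theorem continuous_seminorm (N : Seminorm ℝ F) : Continuous N := by
  have h := N.convexOn.continuousOn isOpen_univ
  exact continuousOn_univ.1 h

theorem exists_norm_le_mul {N : Seminorm ℝ F} (hN : ∀ y, N y = 0 → y = 0) :
    ∃ K : ℝ, 0 < K ∧ ∀ y, ‖y‖ ≤ K * N y := by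
  have : ProperSpace F := FiniteDimensional.proper ℝ F
  rcases (Metric.sphere (0 : F) 1).eq_empty_or_nonempty with he | hne
  · refine ⟨1, one_pos, fun y => ?_⟩
    by_cases hy : y = 0
    · simp [hy]
    · have : ‖y‖⁻¹ • y ∈ Metric.sphere (0 : F) 1 := by
        simp [norm_smul, hy]
      simp [he] at this
  · obtain ⟨w, hw, hmin⟩ := (isCompact_sphere (0 : F) 1).exists_isMinOn hne
      (continuous_seminorm N).continuousOn
    have hw0 : w ≠ 0 := by rintro rfl; simp at hw
    have hpos : 0 < N w := lt_of_le_of_ne (apply_nonneg N w) fun h => hw0 (hN w h.symm)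
    refine ⟨(N w)⁻¹, inv_pos.2 hpos, fun y => ?_⟩
    by_cases hy : y = 0
    · simp [hy]
    · have hy' : 0 < ‖y‖ := norm_pos_iff.2 hy
      have h : N w ≤ N (‖y‖⁻¹ • y) := hmin (by simp [norm_smul, hy])
      rw [map_smul_eq_mul, norm_inv, norm_norm] at h
      rw [inv_mul_eq_div, le_div_iff₀ hpos]
      calc ‖y‖ * N w ≤ ‖y‖ * (‖y‖⁻¹ * N y) := by gcongr
        _ = N y := by field_simp

theorem exists_le_mul_norm (N : Seminorm ℝ F) : ∃ C : ℝ, 0 < C ∧ ∀ y, N y ≤ C * ‖y‖ :=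
  Seminorm.bound_of_continuous_normedSpace N (continuous_seminorm N)

variable {N : Seminorm ℝ F}

theorem bddAbove_dualNorm (hN : ∀ y, N y = 0 → y = 0) (p : F) :
    BddAbove {r : ℝ | ∃ x : F, N x ≤ 1 ∧ r = inner ℝ p x} := by
  obtain ⟨K, hK, h⟩ := exists_norm_le_mul hN
  refine ⟨‖p‖ * K, ?_⟩
  rintro _ ⟨x, hx, rfl⟩
  have : ‖x‖ ≤ K := (h x).trans (by nlinarith)
  exact (real_inner_le_norm p x).trans (by gcongr)

theorem dualNorm_le_iff (hN : ∀ y, N y = 0 → y = 0) {p : F} {l : ℝ} :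
    dualNorm N p ≤ l ↔ ∀ x, N x ≤ 1 → inner ℝ p x ≤ l := by
  rw [dualNorm, csSup_le_iff (bddAbove_dualNorm hN p) ⟨0, 0, by simp⟩]
  exact ⟨fun h x hx => h _ ⟨x, hx, rfl⟩, by rintro h _ ⟨x, hx, rfl⟩; exact h x hx⟩

/-- A dual ball is an intersection of closed half-spaces. -/
theorem isClosed_dualNorm_le (hN : ∀ y, N y = 0 → y = 0) (l : ℝ) :
    IsClosed {p : F | dualNorm N p ≤ l} := by
  simp only [dualNorm_le_iff hN, Set.ofPred_forall]
  exact isClosed_iInter fun x => isClosed_iInter fun _ =>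
    isClosed_le (by fun_prop) continuous_const

theorem lowerSemicontinuous_dualNorm (hN : ∀ y, N y = 0 → y = 0) :
    LowerSemicontinuous (dualNorm N) :=
  lowerSemicontinuous_iff_isClosed_preimage.2 (isClosed_dualNorm_le hN)

theorem inner_le_dualNorm_mul (hN : ∀ y, N y = 0 → y = 0) (p x : F) :
    inner ℝ p x ≤ dualNorm N p * N x := by
  by_cases hx : N x = 0
  · simp [hN x hx]
  · have hpos : 0 < N x := lt_of_le_of_ne (apply_nonneg N x) (Ne.symm hx)
    have h := (dualNorm_le_iff hN (p := p)).1 le_rfl ((N x)⁻¹ • x) (by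
      rw [map_smul_eq_mul, norm_inv, Real.norm_of_nonneg hpos.le, inv_mul_cancel₀ hx])
    rw [inner_smul_right, inv_mul_eq_div, div_le_iff₀ hpos] at h
    exact h

theorem dualNorm_nonneg (hN : ∀ y, N y = 0 → y = 0) (p : F) : 0 ≤ dualNorm N p :=
  le_csSup (bddAbove_dualNorm hN p) ⟨0, by simp⟩

theorem dualNorm_zero (hN : ∀ y, N y = 0 → y = 0) : dualNorm N 0 = 0 :=
  le_antisymm ((dualNorm_le_iff hN).2 (by simp)) (dualNorm_nonneg hN 0)

/-- Pairing `p` with itself gives `‖p‖² ≤ dualNorm N p * N p`, and `N p ≤ C * ‖p‖`. -/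
theorem exists_norm_le_mul_dualNorm (hN : ∀ y, N y = 0 → y = 0) :
    ∃ C : ℝ, 0 < C ∧ ∀ p, ‖p‖ ≤ C * dualNorm N p := by
  obtain ⟨C, hC, h⟩ := exists_le_mul_norm N
  refine ⟨C, hC, fun p => ?_⟩
  by_cases hp : p = 0
  · simpa [hp] using mul_nonneg hC.le (dualNorm_nonneg hN 0)
  · have hp' : 0 < ‖p‖ := norm_pos_iff.2 hp
    have h1 := inner_le_dualNorm_mul hN p p
    rw [real_inner_self_eq_norm_mul_norm] at h1
    have h2 : dualNorm N p * N p ≤ dualNorm N p * (C * ‖p‖) :=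
      mul_le_mul_of_nonneg_left (h p) (dualNorm_nonneg hN p)
    exact le_of_mul_le_mul_right (by linarith) hp'

end Norms

/-! ### Feasibility and joint coercivity. -/

section Setting

variable {Φ : E → EReal} {X₁ X₂ X₃ : Submodule ℝ E}

theorem IsSetting.exists_feasible (h : IsSetting Φ X₁ X₂ X₃) (A : E →ₗ[ℝ] F) (N : Seminorm ℝ F)
    {τ : ℝ} (hτ : 0 < τ) : ∃ x, ∃ c : ℝ, Φ x = c ∧ N (A x) ≤ τ := by
  have hcont : Continuous fun x : X₁ => N (A x) :=
    (continuous_seminorm N).comp (A.continuous_of_finiteDimensional.comp continuous_subtype_val)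
  have hnhds : {x : X₁ | N (A x) < τ} ∈ 𝓝 (0 : X₁) :=
    (isOpen_lt hcont continuous_const).mem_nhds (by simpa using hτ)
  obtain ⟨x, hx, hdom⟩ := mem_closure_iff_nhds.1 h.zero_mem _ hnhds
  exact ⟨x, (Φ x).toReal, (EReal.coe_toReal (ne_of_lt hdom) (h.gammaZero.ne_bot x)).symm, hx.le⟩

/-- If `A` is injective on `X₂`, then `Φ` and `N ∘ A` are jointly coercive. -/
theorem IsSetting.bounded_sublevel (h : IsSetting Φ X₁ X₂ X₃) {A : E →ₗ[ℝ] F} {N : Seminorm ℝ F}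
    (hN : ∀ y, N y = 0 → y = 0) (hX₂ : X₂ ⊓ LinearMap.ker A = ⊥) (c t : ℝ) :
    ∃ R : ℝ, ∀ x, Φ x ≤ c → N (A x) ≤ t → ‖x‖ ≤ R := by
  obtain ⟨R, hR⟩ := h.gammaZero.bounded_sublevel h.strictlyConvex h.exists_minimizer c
  obtain ⟨K, hK, hNK⟩ := exists_norm_le_mul hN
  have hker : LinearMap.ker (A.domRestrict X₂) = ⊥ := by
    refine LinearMap.ker_eq_bot'.2 fun x hx => ?_
    have : (x : E) ∈ X₂ ⊓ LinearMap.ker A := ⟨x.2, hx⟩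
    rw [hX₂] at this
    exact Subtype.ext this
  -- An injective linear map in finite dimension is bounded below; this recovers `x₂` from `A x₂ = A
  -- x - A x₁`.
  obtain ⟨κ, -, hκ⟩ := LinearMap.exists_antilipschitzWith _ hker
  set T := LinearMap.toContinuousLinearMap A
  refine ⟨R + κ * (K * t + ‖T‖ * R), fun x hx hNx => ?_⟩
  obtain ⟨x₁, h₁, x₂, h₂, rfl, he⟩ := h.exists_decomposition (hx.trans_lt (EReal.coe_lt_top c))
  have hx₁ : ‖x₁‖ ≤ R := hR ⟨x₁, h₁⟩ (he ▸ hx)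
  have hx₂ : ‖x₂‖ ≤ κ * ‖A x₂‖ := by
    simpa using hκ.le_mul_dist ⟨x₂, h₂⟩ 0
  have hA₂ : ‖A x₂‖ ≤ ‖A (x₁ + x₂)‖ + ‖A x₁‖ := by
    have : A x₂ = A (x₁ + x₂) - A x₁ := by simp
    rw [this]
    exact norm_sub_le _ _
  have hA₁ : ‖A x₁‖ ≤ ‖T‖ * R := (T.le_opNorm x₁).trans (by gcongr)
  have hA : ‖A (x₁ + x₂)‖ ≤ K * t := (hNK _).trans (by gcongr)
  calc ‖x₁ + x₂‖ ≤ ‖x₁‖ + ‖x₂‖ := norm_add_le _ _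
    _ ≤ R + κ * ‖A x₂‖ := add_le_add hx₁ hx₂
    _ ≤ R + κ * (K * t + ‖T‖ * R) := by gcongr; linarith

variable {A : E →ₗ[ℝ] F} {B : F →ₗ[ℝ] E} {N : Seminorm ℝ F}

/-! ### The primal problems. -/

theorem IsSetting.hasSolution_constrained_primal (h : IsSetting Φ X₁ X₂ X₃) (hΦ : IsGammaZero Φ)
    (hN : ∀ y, N y = 0 → y = 0) (hX₂ : X₂ ⊓ LinearMap.ker A = ⊥) {τ : ℝ} (hτ : 0 < τ) :
    HasSolutionWithFiniteMin Φ {x | N (A x) ≤ τ} := by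
  obtain ⟨x₀, c, hc, hx₀⟩ := h.exists_feasible A N hτ
  obtain ⟨R, hR⟩ := h.bounded_sublevel hN hX₂ c τ
  exact hasSolutionWithFiniteMin_of_bounded hΦ.lsc
    (isClosed_le ((continuous_seminorm N).comp A.continuous_of_finiteDimensional)
      continuous_const)
    (fun x _ => hΦ.ne_bot x) hx₀ (hc ▸ EReal.coe_lt_top c) fun x hx hle => hR x (hc ▸ hle) hx

theorem IsSetting.hasSolution_penalized_primal (h : IsSetting Φ X₁ X₂ X₃) (hΦ : IsGammaZero Φ)
    (hN : ∀ y, N y = 0 → y = 0) (hX₂ : X₂ ⊓ LinearMap.ker A = ⊥) {l : ℝ} (hl : 0 < l) :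
    HasSolutionWithFiniteMin (fun x => Φ x + ((l * N (A x) : ℝ) : EReal)) Set.univ := by
  obtain ⟨x₀, c, hc, -⟩ := h.exists_feasible A N one_pos
  obtain ⟨μ, hμ⟩ := h.exists_lowerBound
  set d := c + l * N (A x₀) with hd
  -- Since `Φ ≥ μ`, a total value of at most `d` leaves at most `d - μ` for the penalty.
  obtain ⟨R, hR⟩ := h.bounded_sublevel hN hX₂ d ((d - μ) / l)
  have hval : Φ x₀ + ((l * N (A x₀) : ℝ) : EReal) = (d : ℝ) := by rw [hc, hd, EReal.coe_add]
  refine hasSolutionWithFiniteMin_of_bounded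
    (lowerSemicontinuous_add_coe hΦ.lsc (Continuous.lowerSemicontinuous (continuous_const.mul
      ((continuous_seminorm N).comp A.continuous_of_finiteDimensional))))
    isClosed_univ (fun x _ => add_coe_ne_bot (hΦ.ne_bot x) _) (Set.mem_univ x₀)
    (hval ▸ EReal.coe_lt_top d) (R := R) fun x _ hle => ?_
  have hle' : Φ x + ((l * N (A x) : ℝ) : EReal) ≤ (d : ℝ) := hval ▸ hle
  have hnonneg : 0 ≤ l * N (A x) := mul_nonneg hl.le (apply_nonneg N _)
  refine hR x (le_trans ?_ hle') ?_
  · exact le_add_of_nonneg_right (EReal.coe_nonneg.2 hnonneg)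
  · have h2 := (add_le_add_left (hμ x) ((l * N (A x) : ℝ) : EReal)).trans hle'
    rw [← EReal.coe_add, EReal.coe_le_coe_iff] at h2
    rw [le_div_iff₀ hl]
    linarith

/-! ### The dual problems. -/

theorem IsSetting.conjugate_ne_bot (h : IsSetting Φ X₁ X₂ X₃) (p : E) : conjugate Φ p ≠ ⊥ := by
  -- The zero map makes the constraint void: only a point of finite value is needed.
  obtain ⟨x, c, hc, -⟩ := h.exists_feasible (0 : E →ₗ[ℝ] E) 0 one_pos
  exact ne_bot_of_le_ne_bot (EReal.coe_ne_bot _) (coe_le_conjugate hc p)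

theorem IsSetting.hasSolution_constrained_dual (h : IsSetting Φ X₁ X₂ X₃)
    (hN : ∀ y, N y = 0 → y = 0) (B : F →ₗ[ℝ] E) {l : ℝ} (hl : 0 < l) :
    HasSolutionWithFiniteMin (fun p => conjugate Φ (-(B p))) {p | dualNorm N p ≤ l} := by
  obtain ⟨b, hb⟩ := h.exists_conjugate_zero_le
  obtain ⟨C, hC, hCN⟩ := exists_norm_le_mul_dualNorm hN
  refine hasSolutionWithFiniteMin_of_bounded
    ((lowerSemicontinuous_conjugate Φ).comp B.continuous_of_finiteDimensional.neg)
    (isClosed_dualNorm_le hN l) (fun p _ => h.conjugate_ne_bot _) (x₀ := 0)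
    (by simpa [dualNorm_zero hN] using hl.le)
    (by simpa using hb.trans_lt (EReal.coe_lt_top b)) (R := C * l) fun p hp _ => ?_
  exact (hCN p).trans (by gcongr; exact hp)

theorem IsSetting.hasSolution_penalized_dual (h : IsSetting Φ X₁ X₂ X₃)
    (hN : ∀ y, N y = 0 → y = 0) (hB : ∀ p x, inner ℝ (B p) x = inner ℝ p (A x))
    {τ : ℝ} (hτ : 0 < τ) :
    HasSolutionWithFiniteMin
      (fun p => conjugate Φ (-(B p)) + ((τ * dualNorm N p : ℝ) : EReal)) Set.univ := by
  obtain ⟨b, hb⟩ := h.exists_conjugate_zero_le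
  obtain ⟨x, c, hc, hx⟩ := h.exists_feasible A N (half_pos hτ)
  obtain ⟨C, hC, hCN⟩ := exists_norm_le_mul_dualNorm hN
  have hval : conjugate Φ (-(B 0)) + ((τ * dualNorm N 0 : ℝ) : EReal) ≤ b := by
    simpa [dualNorm_zero hN] using hb
  have hlsc : LowerSemicontinuous fun p => τ * dualNorm N p :=
    (continuous_const_mul τ).comp_lowerSemicontinuous (lowerSemicontinuous_dualNorm hN)
      fun _ _ hab => mul_le_mul_of_nonneg_left hab hτ.le
  refine hasSolutionWithFiniteMin_of_bounded
    (lowerSemicontinuous_add_coe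
      ((lowerSemicontinuous_conjugate Φ).comp B.continuous_of_finiteDimensional.neg) hlsc)
    isClosed_univ (fun p _ => add_coe_ne_bot (h.conjugate_ne_bot _) _) (Set.mem_univ 0)
    (hval.trans_lt (EReal.coe_lt_top b)) (R := C * ((b + c) / (τ / 2))) fun p _ hle => ?_
  -- Fenchel at `x`: `-⟨p, A x⟩ - c + τ * dualNorm N p ≤ b`. As `⟨p, A x⟩` absorbs at most half of
  -- the penalty, `(τ / 2) * dualNorm N p ≤ b + c`.
  have h1 := (add_le_add_left (coe_le_conjugate hc (-(B p)))
    ((τ * dualNorm N p : ℝ) : EReal)).trans (hle.trans hval)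
  rw [← EReal.coe_add, EReal.coe_le_coe_iff, inner_neg_left, hB] at h1
  have h2 : inner ℝ p (A x) ≤ dualNorm N p * (τ / 2) :=
    (inner_le_dualNorm_mul hN p (A x)).trans
      (mul_le_mul_of_nonneg_left hx (dualNorm_nonneg hN p))
  refine (hCN p).trans (mul_le_mul_of_nonneg_left ?_ hC.le)
  rw [le_div_iff₀ (half_pos hτ)]
  linarith

end Setting

end FiniteDimensional

end Solvers

theorem mainTheorem10 {n m : ℕ}
    (Φ : EuclideanSpace ℝ (Fin n) → EReal)
    (X₁ X₂ X₃ : Submodule ℝ (EuclideanSpace ℝ (Fin n)))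
    (L : Matrix (Fin m) (Fin n) ℝ)
    (N : Seminorm ℝ (EuclideanSpace ℝ (Fin m)))
    (hN : ∀ y, N y = 0 → y = 0)
    (hΦ : Solvers.IsGammaZero Φ)
    (hset : Solvers.IsSetting Φ X₁ X₂ X₃)
    (hX₂ : X₂ ⊓ LinearMap.ker (Matrix.toEuclideanLin L) = ⊥)
    (hargmin : Solvers.argmin Φ ∩
      (LinearMap.ker (Matrix.toEuclideanLin L) : Set (EuclideanSpace ℝ (Fin n))) = ∅) :
    (∀ τ : ℝ, 0 < τ →
      Solvers.HasSolutionWithFiniteMin Φ {x | N (Matrix.toEuclideanLin L x) ≤ τ} ∧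
      Solvers.HasSolutionWithFiniteMin
        (fun p => Solvers.conjugate Φ (-(Matrix.toEuclideanLin L.transpose p)) +
          ((τ * Solvers.dualNorm N p : ℝ) : EReal)) Set.univ) ∧
    (∀ l : ℝ, 0 < l →
      Solvers.HasSolutionWithFiniteMin
        (fun x => Φ x + ((l * N (Matrix.toEuclideanLin L x) : ℝ) : EReal)) Set.univ ∧
      Solvers.HasSolutionWithFiniteMin
        (fun p => Solvers.conjugate Φ (-(Matrix.toEuclideanLin L.transpose p)))
        {p | Solvers.dualNorm N p ≤ l}) := by
  have hadj : ∀ p x, inner ℝ (Matrix.toEuclideanLin L.transpose p) x =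
      inner ℝ p (Matrix.toEuclideanLin L x) := fun p x => by
    rw [← Matrix.conjTranspose_eq_transpose_of_trivial,
      Matrix.toEuclideanLin_conjTranspose_eq_adjoint, LinearMap.adjoint_inner_left]
  exact ⟨fun τ hτ => ⟨hset.hasSolution_constrained_primal hΦ hN hX₂ hτ,
      hset.hasSolution_penalized_dual hN hadj hτ⟩,
    fun l hl => ⟨hset.hasSolution_penalized_primal hΦ hN hX₂ hl,
      hset.hasSolution_constrained_dual hN _ hl⟩⟩
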